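/- Let $G=(V,E)$ be a finite simple undirected graph with $n(G)=|V|$ and $m(G)=|E|$. Let $\alpha(G)$ be the maximum size of an independent set of $G$ and $\mu(G)$ the maximum size of a matching of $G$; $G$ is a König–Egerváry graph if $\alpha(G)+\mu(G)=n(G)$. Let $\mathrm{core}(G)$ be the intersection of all maximum independent sets of $G$. For $X\subseteq V$ let $N(X)$ be the set of vertices having a neighbor in $X$, and let $d(X)=|X|-|N(X)|$; an independent set $A$ is critical if $d(A)=\max\{d(X):X\subseteq V\}$, and $\ker(G)$ is the intersection of all critical independent sets of $G$. Let $\varrho_v(G)$ be the number of vertices $v\in V$ such that $G-v$ is a König–Egerváry graph, and $\varrho_e(G)$ the number of edges $e\in E$ such that $G-e$ is a König–Egerváry graph (where $G-e$ is obtained by deleting only the edge $e$, keeping all vertices). If $G$ is a König–Egerváry graph, then: (i) $\varrho_v(G)=n(G)$ if and only if $\mathrm{core}(G)=\ker(G)$; (ii) if $\mathrm{core}(G)=\ker(G)$, then $\varrho_e(G)=m(G)$. -/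

import Mathlib

namespace SimpleGraph

variable {V : Type*}

/-- The matching number `μ(G)`: the maximum number of edges of a matching of the finite
graph `G`. -/
noncomputable def matchingNum (G : SimpleGraph V) : ℕ :=
  sSup {k | ∃ M : G.Subgraph, M.IsMatching ∧ M.edgeSet.ncard = k}

/-- `G` is a König–Egerváry graph: `α(G) + μ(G) = n(G)`. -/
def IsKonigEgervary (G : SimpleGraph V) : Prop :=
  G.indepNum + G.matchingNum = Nat.card V

/-- The neighborhood `N(A) = {v : N(v) ∩ A ≠ ∅}` of a set of vertices. -/
def setNeighborhood (G : SimpleGraph V) (A : Set V) : Set V :=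
  {v | (G.neighborSet v ∩ A).Nonempty}

/-- The difference `d(X) = |X| - |N(X)|`. -/
noncomputable def difference (G : SimpleGraph V) (X : Finset V) : ℤ :=
  (X.card : ℤ) - ((G.setNeighborhood (X : Set V)).ncard : ℤ)

/-- The critical difference `d(G)`: the maximum of `d(X)` over all sets `X` of vertices of the
finite graph `G`. -/
noncomputable def criticalDifference (G : SimpleGraph V) : ℤ :=
  ⨆ X : Finset V, G.difference X

/-- `A` is a critical independent set: `A` is independent and `d(A) = d(G)`. -/
def IsCriticalIndepSet (G : SimpleGraph V) (A : Finset V) : Prop :=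
  G.IsIndepSet (A : Set V) ∧ G.difference A = G.criticalDifference

/-- `core(G)`: the intersection of all maximum independent sets. -/
def core [Finite V] (G : SimpleGraph V) : Set V :=
  ⋂ S ∈ {S : Finset V | G.IsMaximumIndepSet S}, (S : Set V)

/-- `ker(G)`: the intersection of all critical independent sets. -/
def ker (G : SimpleGraph V) : Set V :=
  ⋂ A ∈ {A : Finset V | G.IsCriticalIndepSet A}, (A : Set V)

/-- `ϱ_v(G)`: the number of vertices `v` such that `G - v` is a König–Egerváry graph. -/
noncomputable def vertexHeredity (G : SimpleGraph V) : ℕ :=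
  {v : V | (G.induce ({v}ᶜ : Set V)).IsKonigEgervary}.ncard

/-- `ϱ_e(G)`: the number of edges `e` such that `G - e` is a König–Egerváry graph. -/
noncomputable def edgeHeredity (G : SimpleGraph V) : ℕ :=
  {e : Sym2 V | e ∈ G.edgeSet ∧ (G.deleteEdges {e}).IsKonigEgervary}.ncard

end SimpleGraph

/-!
For a König–Egerváry graph everything is governed by pairs `(S, f)`, where `S` is an independent
set and `f` matches `Sᶜ` injectively along edges into `S`. Such a pair certifies that the graph is
König–Egerváry (`IsKonigEgervary.of_isSaturating`), and conversely every maximum independent set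
`S` of a König–Egerváry graph admits such an `f`
(`IsKonigEgervary.exists_isSaturating`). A pair `(S, f)` also bounds every difference:
`|A| - |N(A)| ≤ |S| - |Sᶜ|` (`IsSaturating.card_add_card_compl_le`). Hence in a
König–Egerváry graph `d(G) = 2 α(G) - n(G)`, maximum independent sets are critical, and
`ker G ⊆ core G`.

The central fact is that a vertex `v` of `ker G` can be avoided by a maximum matching
(`IsKonigEgervary.exists_isSaturating_avoiding`). By Hall's theorem, an obstruction is a set
`Y ⊆ Sᶜ` with `|N(Y) ∩ (S \ {v})| < |Y|`, and then `S \ N(Y)` is a critical independent set missing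
`v`.

Vertices: if `v ∉ core G`, some pair `(S, f)` with `v ∉ S` restricts to `G - v`. If `v ∈ ker G`, a
pair avoiding `v` restricts to `G - v`. If `v ∈ core G` and `G - v` is König–Egerváry, its own pair
shows that sets missing `v` have difference below `d(G)`, so `v ∈ ker G`. Thus `G - v` is
König–Egerváry exactly when `v ∉ core G` or `v ∈ ker G`.

Edges: let `e = ab` and `core G = ker G`. If `a` or `b` lies in `core G`, a maximum matching avoiding
that endpoint avoids `e`. Otherwise there are maximum independent sets `S` missing `a` and `S'`
missing `b`. If no maximum matching avoids `e`, then Hall's theorem yields `Y ⊆ Sᶜ` for which `f '' Y`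
is the set of `S`-neighbours of `Y`, contains `b`, and `a` is the only neighbour of `b` in `Y`.
Exchanging `S` for `S'` on `Y ∪ f '' Y` and then adding `b` gives an independent set of `G - e` with
`α(G) + 1` vertices, which compensates for the loss of one matching edge.
-/

namespace SimpleGraph

variable {V : Type*}

/-! ### Independent sets, neighbourhoods and saturating maps -/

/-- The map `f` matches the complement of `S` into `S`: it is injective on `Sᶜ` and sends each
`x ∉ S` to a neighbour of `x` in `S`. Values of `f` on `S` are irrelevant. -/
def IsSaturating (G : SimpleGraph V) (S : Finset V) (f : V → V) : Prop :=
  Set.InjOn f (S : Set V)ᶜ ∧ ∀ x ∉ S, f x ∈ S ∧ G.Adj x (f x)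

lemma not_adj_of_isIndepSet {G : SimpleGraph V} {S : Finset V} (hS : G.IsIndepSet (S : Set V))
    {x y : V} (hx : x ∈ S) (hy : y ∈ S) : ¬ G.Adj x y :=
  fun h => hS hx hy h.ne h

lemma isIndepSet_of_forall_not_adj {G : SimpleGraph V} {S : Finset V}
    (h : ∀ x ∈ S, ∀ y ∈ S, ¬ G.Adj x y) : G.IsIndepSet (S : Set V) :=
  fun x hx y hy _ => h x hx y hy

lemma exists_isMaximumIndepSet [Finite V] (G : SimpleGraph V) :
    ∃ S : Finset V, G.IsMaximumIndepSet S := by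
  obtain ⟨S, hS⟩ := G.exists_isNIndepSet_indepNum
  exact ⟨S, hS.isIndepSet, fun t ht => hS.card_eq ▸ ht.card_le_indepNum⟩

lemma IsMaximumIndepSet.card_eq [Finite V] {G : SimpleGraph V} {S : Finset V}
    (hS : G.IsMaximumIndepSet S) : S.card = G.indepNum := by
  obtain ⟨T, hT⟩ := G.exists_isNIndepSet_indepNum
  exact le_antisymm hS.isIndepSet.card_le_indepNum (hT.card_eq ▸ hS.maximum T hT.isIndepSet)

lemma mem_core [Finite V] {G : SimpleGraph V} {v : V} :
    v ∈ G.core ↔ ∀ S : Finset V, G.IsMaximumIndepSet S → v ∈ S := by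
  simp [core]

lemma mem_ker {G : SimpleGraph V} {v : V} :
    v ∈ G.ker ↔ ∀ S : Finset V, G.IsCriticalIndepSet S → v ∈ S := by
  simp [ker]

open scoped Classical in
/-- The neighbourhood of a finite set of vertices as a finite set. -/
noncomputable def nbhd [Fintype V] (G : SimpleGraph V) (A : Finset V) : Finset V :=
  {x | ∃ y ∈ A, G.Adj x y}

lemma mem_nbhd [Fintype V] {G : SimpleGraph V} {A : Finset V} {x : V} :
    x ∈ G.nbhd A ↔ ∃ y ∈ A, G.Adj x y := by
  simp [nbhd]

lemma difference_eq [Fintype V] (G : SimpleGraph V) (A : Finset V) :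
    G.difference A = (A.card : ℤ) - (G.nbhd A).card := by
  rw [difference, ← Set.ncard_coe_finset (G.nbhd A)]
  congr 3
  ext x
  simp only [setNeighborhood, Set.mem_ofPred_eq, Finset.mem_coe, mem_nbhd]
  exact ⟨fun ⟨y, h1, h2⟩ => ⟨y, h2, h1⟩, fun ⟨y, h1, h2⟩ => ⟨y, h2, h1⟩⟩

lemma deleteEdges_singleton_adj {G : SimpleGraph V} {a b x y : V} :
    (G.deleteEdges {s(a, b)}).Adj x y ↔ G.Adj x y ∧ ¬ (x = a ∧ y = b ∨ x = b ∧ y = a) := by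
  simp [deleteEdges_adj]

/-! ### Independent sets against matchings -/

/-- Each edge of a matching has an endpoint outside a given independent set, and distinct edges
have distinct such endpoints. -/
lemma exists_injective_endpoint {G : SimpleGraph V} {S : Finset V}
    (hS : G.IsIndepSet (S : Set V)) {M : G.Subgraph} (hM : M.IsMatching) :
    ∃ g : M.edgeSet → {x // x ∉ S}, Function.Injective g ∧
      ∀ e : M.edgeSet, (g e : V) ∈ (e : Sym2 V) := by
  have key : ∀ e : M.edgeSet, ∃ x : {x // x ∉ S}, (x : V) ∈ (e : Sym2 V) := by
    rintro ⟨e, he⟩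
    obtain ⟨b, hb, hbe⟩ := hS.nonempty_mem_compl_mem_edge (G := G) (M.edgeSet_subset he)
    exact ⟨⟨b, by simpa using hb⟩, hbe⟩
  choose g hg using key
  refine ⟨g, ?_, hg⟩
  rintro ⟨e, he⟩ ⟨e', he'⟩ h
  have h1 := hg ⟨e, he⟩
  have h2 := hg ⟨e', he'⟩
  rw [← h] at h2
  generalize (g ⟨e, he⟩ : V) = x at h1 h2
  obtain ⟨y, rfl⟩ := Sym2.mem_iff_exists.1 h1
  obtain ⟨z, rfl⟩ := Sym2.mem_iff_exists.1 h2
  have : y = z := hM.eq_of_adj_left he he'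
  subst this
  rfl

section Fintype

variable [Fintype V] [DecidableEq V]

lemma card_add_ncard_edgeSet_le {G : SimpleGraph V} {S : Finset V}
    (hS : G.IsIndepSet (S : Set V)) {M : G.Subgraph} (hM : M.IsMatching) :
    S.card + M.edgeSet.ncard ≤ Nat.card V := by
  obtain ⟨g, hg, -⟩ := exists_injective_endpoint hS hM
  have h := Nat.card_le_card_of_injective g hg
  have h2 : Nat.card {x // x ∉ S} = Sᶜ.card := by
    rw [← Nat.card_eq_finsetCard]
    simp
  rw [Nat.card_coe_set_eq, h2, Finset.card_compl] at h
  have := S.card_le_univ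
  rw [Nat.card_eq_fintype_card]
  omega

lemma bddAbove_matching (G : SimpleGraph V) :
    BddAbove {k | ∃ M : G.Subgraph, M.IsMatching ∧ M.edgeSet.ncard = k} := by
  refine ⟨Nat.card V, ?_⟩
  rintro k ⟨M, hM, rfl⟩
  have := card_add_ncard_edgeSet_le (S := ∅) (by simp) hM
  omega

lemma exists_isMatching_ncard_eq_matchingNum (G : SimpleGraph V) :
    ∃ M : G.Subgraph, M.IsMatching ∧ M.edgeSet.ncard = G.matchingNum := by
  have hne : {k | ∃ M : G.Subgraph, M.IsMatching ∧ M.edgeSet.ncard = k}.Nonempty :=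
    ⟨_, ⊥, fun v hv => hv.elim, rfl⟩
  exact Nat.sSup_mem hne (bddAbove_matching G)

/-- An injection along edges from `P` to the complement of `P` is a matching with `|P|` edges. -/
lemma card_le_matchingNum {G : SimpleGraph V} {P : Finset V} {f : V → V}
    (hinj : Set.InjOn f (P : Set V)) (hf : ∀ x ∈ P, f x ∉ P ∧ G.Adj x (f x)) :
    P.card ≤ G.matchingNum := by
  let M : G.Subgraph :=
    { verts := {x | x ∈ P ∨ ∃ y ∈ P, f y = x}
      Adj := fun v w => (v ∈ P ∧ f v = w) ∨ (w ∈ P ∧ f w = v)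
      adj_sub := by
        rintro v w (⟨h, rfl⟩ | ⟨h, rfl⟩)
        · exact (hf _ h).2
        · exact (hf _ h).2.symm
      edge_vert := by
        rintro v w (⟨h, rfl⟩ | ⟨h, rfl⟩)
        · exact Or.inl h
        · exact Or.inr ⟨w, h, rfl⟩
      symm := ⟨fun v w h => h.symm⟩ }
  have hM : M.IsMatching := by
    rintro v (hv | ⟨y, hy, rfl⟩)
    · refine ⟨f v, Or.inl ⟨hv, rfl⟩, ?_⟩
      rintro w (⟨_, rfl⟩ | ⟨hw, rfl⟩)
      · rfl
      · exact absurd hv (hf _ hw).1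
    · refine ⟨y, Or.inr ⟨hy, rfl⟩, ?_⟩
      rintro w (⟨h, _⟩ | ⟨hw, h⟩)
      · exact absurd h (hf _ hy).1
      · exact hinj hw hy h
  have hle : P.card ≤ M.edgeSet.ncard := by
    rw [← Set.ncard_coe_finset P]
    refine Set.ncard_le_ncard_of_injOn (fun x => s(x, f x)) ?_ ?_ (Set.toFinite _)
    · intro x hx
      exact Or.inl ⟨hx, rfl⟩
    · intro x hx y hy h
      rcases Sym2.eq_iff.1 h with ⟨h, -⟩ | ⟨h, -⟩
      · exact h
      · exact absurd (h ▸ hx : f y ∈ (P : Set V)) (hf y hy).1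
  exact hle.trans (le_csSup (bddAbove_matching G) ⟨M, hM, rfl⟩)

lemma indepNum_add_matchingNum_le (G : SimpleGraph V) :
    G.indepNum + G.matchingNum ≤ Nat.card V := by
  obtain ⟨S, hS⟩ := G.exists_isNIndepSet_indepNum
  obtain ⟨M, hM, h⟩ := G.exists_isMatching_ncard_eq_matchingNum
  rw [← hS.card_eq, ← h]
  exact card_add_ncard_edgeSet_le hS.isIndepSet hM

lemma IsKonigEgervary.of_card_le {G : SimpleGraph V} {S P : Finset V} {f : V → V}
    (hS : G.IsIndepSet (S : Set V)) (hinj : Set.InjOn f (P : Set V))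
    (hf : ∀ x ∈ P, f x ∉ P ∧ G.Adj x (f x)) (hcard : Nat.card V ≤ S.card + P.card) :
    G.IsKonigEgervary :=
  le_antisymm G.indepNum_add_matchingNum_le
    (hcard.trans (add_le_add hS.card_le_indepNum (card_le_matchingNum hinj hf)))

lemma IsKonigEgervary.of_isSaturating {G : SimpleGraph V} {S : Finset V} {f : V → V}
    (hS : G.IsIndepSet (S : Set V)) (hf : G.IsSaturating S f) : G.IsKonigEgervary := by
  refine .of_card_le (P := Sᶜ) hS (by simpa using hf.1) (fun x hx => ?_) ?_
  · have := hf.2 x (by simpa using hx)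
    exact ⟨by simpa using this.1, this.2⟩
  · rw [Finset.card_add_card_compl, Nat.card_eq_fintype_card]

/-- A maximum matching has exactly `|Sᶜ|` edges, so choosing for each edge an endpoint outside `S`
is a bijection onto `Sᶜ`. Its edges therefore join `Sᶜ` to `S`. -/
lemma IsKonigEgervary.exists_isSaturating {G : SimpleGraph V} (hG : G.IsKonigEgervary)
    {S : Finset V} (hS : G.IsMaximumIndepSet S) : ∃ f, G.IsSaturating S f := by
  obtain ⟨M, hM, hMc⟩ := G.exists_isMatching_ncard_eq_matchingNum
  obtain ⟨g, hg, hge⟩ := exists_injective_endpoint hS.isIndepSet hM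
  have hbij : Function.Bijective g := by
    rw [Nat.bijective_iff_injective_and_card]
    refine ⟨hg, ?_⟩
    have h2 : Nat.card {x // x ∉ S} = Sᶜ.card := by
      rw [← Nat.card_eq_finsetCard]; simp
    rw [Nat.card_coe_set_eq, h2, Finset.card_compl, hMc, hS.card_eq, ← Nat.card_eq_fintype_card,
      ← hG]
    omega
  have key : ∀ x, ∃ y, x ∉ S → M.Adj x y ∧ ∃ h : s(x, y) ∈ M.edgeSet, (g ⟨_, h⟩ : V) = x := by
    intro x
    by_cases hx : x ∈ S
    · exact ⟨x, fun h => absurd hx h⟩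
    · obtain ⟨⟨e, he⟩, hex⟩ := hbij.2 ⟨x, hx⟩
      have h1 := hge ⟨e, he⟩
      rw [hex] at h1
      obtain ⟨y, rfl⟩ := Sym2.mem_iff_exists.1 h1
      exact ⟨y, fun _ => ⟨he, he, by rw [hex]⟩⟩
  choose f hf using key
  refine ⟨f, ?_, ?_⟩
  · intro x hx y hy hxy
    have h1 := (hf x hx).1
    have h2 := (hf y hy).1
    rw [← hxy] at h2
    exact hM.eq_of_adj_right h1 h2
  · intro x hx
    obtain ⟨hadj, he, hgx⟩ := hf x hx
    refine ⟨?_, hadj.adj_sub⟩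
    -- otherwise the endpoints `x` and `f x` would both be chosen for the same edge
    by_contra hfx
    obtain ⟨hadj', he', hgx'⟩ := hf (f x) hfx
    have h3 : f (f x) = x := hM.eq_of_adj_left hadj' hadj.symm
    have h4 : (⟨_, he'⟩ : M.edgeSet) = ⟨_, he⟩ := by
      apply Subtype.ext
      change s(f x, f (f x)) = s(x, f x)
      rw [h3]
      exact Sym2.eq_swap
    rw [h4, hgx] at hgx'
    exact hadj.ne hgx'

/-! ### Critical sets -/

/-- Every set `A` satisfies `|A| - |N(A)| ≤ |S| - |Sᶜ|`: matched vertices of `A` have their partners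
in `N(A)`, and only `|S| - |Sᶜ|` vertices are unmatched. -/
lemma IsSaturating.card_add_card_compl_le {G : SimpleGraph V} {S : Finset V} {f : V → V}
    (hf : G.IsSaturating S f) (A : Finset V) :
    A.card + Sᶜ.card ≤ (G.nbhd A).card + S.card := by
  obtain ⟨hinj, hfS⟩ := hf
  set B : Finset V := {x ∈ Sᶜ | f x ∈ A} with hB
  have injOn : ∀ T : Finset V, T ⊆ Sᶜ → Set.InjOn f (T : Set V) := fun T hT =>
    hinj.mono fun x hx => by simpa using hT hx
  have h1 : (A \ S).card ≤ (G.nbhd A ∩ S).card := by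
    rw [← Finset.card_image_of_injOn (injOn (A \ S) fun x hx => by simpa using (Finset.mem_sdiff.1 hx).2)]
    apply Finset.card_le_card
    intro y hy
    obtain ⟨x, hx, rfl⟩ := Finset.mem_image.1 hy
    rw [Finset.mem_sdiff] at hx
    have := hfS x hx.2
    exact Finset.mem_inter.2 ⟨mem_nbhd.2 ⟨x, hx.1, this.2.symm⟩, this.1⟩
  have h2 : B.card ≤ (G.nbhd A \ S).card := by
    apply Finset.card_le_card
    intro x hx
    simp only [hB, Finset.mem_filter, Finset.mem_compl] at hx
    exact Finset.mem_sdiff.2 ⟨mem_nbhd.2 ⟨f x, hx.2, (hfS x hx.1).2⟩, hx.1⟩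
  have h3 : (A ∩ S).card + (Sᶜ \ B).card ≤ S.card := by
    rw [← Finset.card_image_of_injOn (injOn (Sᶜ \ B) Finset.sdiff_subset),
      ← Finset.card_union_of_disjoint]
    · apply Finset.card_le_card
      intro y hy
      rcases Finset.mem_union.1 hy with hy | hy
      · exact (Finset.mem_inter.1 hy).2
      · obtain ⟨x, hx, rfl⟩ := Finset.mem_image.1 hy
        simp only [Finset.mem_sdiff, Finset.mem_compl] at hx
        exact (hfS x hx.1).1
    · rw [Finset.disjoint_left]
      intro y hy hy'
      obtain ⟨x, hx, rfl⟩ := Finset.mem_image.1 hy'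
      simp only [hB, Finset.mem_sdiff, Finset.mem_compl, Finset.mem_filter] at hx
      exact hx.2 ⟨hx.1, (Finset.mem_inter.1 hy).1⟩
  have h4 := Finset.card_sdiff_add_card_inter A S
  have h5 := Finset.card_sdiff_add_card_inter (G.nbhd A) S
  have h6 := Finset.card_sdiff_add_card_eq_card (show B ⊆ Sᶜ from Finset.filter_subset _ _)
  omega

lemma IsSaturating.nbhd_eq_compl {G : SimpleGraph V} {S : Finset V} {f : V → V}
    (hS : G.IsIndepSet (S : Set V)) (hf : G.IsSaturating S f) : G.nbhd S = Sᶜ := by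
  ext x
  rw [mem_nbhd, Finset.mem_compl]
  exact ⟨fun ⟨y, hy, h⟩ hx => not_adj_of_isIndepSet hS hx hy h,
    fun hx => ⟨f x, hf.2 x hx⟩⟩

lemma IsSaturating.criticalDifference_eq {G : SimpleGraph V} {S : Finset V} {f : V → V}
    (hS : G.IsIndepSet (S : Set V)) (hf : G.IsSaturating S f) :
    G.criticalDifference = (S.card : ℤ) - Sᶜ.card := by
  apply IsLUB.ciSup_eq
  refine IsGreatest.isLUB ⟨⟨S, ?_⟩, ?_⟩
  · rw [difference_eq, hf.nbhd_eq_compl hS]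
  · rintro _ ⟨A, rfl⟩
    have := hf.card_add_card_compl_le A
    rw [difference_eq]
    omega

lemma IsSaturating.isCriticalIndepSet_iff {G : SimpleGraph V} {S : Finset V} {f : V → V}
    (hS : G.IsIndepSet (S : Set V)) (hf : G.IsSaturating S f) {A : Finset V} :
    G.IsCriticalIndepSet A ↔
      G.IsIndepSet (A : Set V) ∧ (G.nbhd A).card + S.card ≤ A.card + Sᶜ.card := by
  rw [IsCriticalIndepSet, hf.criticalDifference_eq hS, difference_eq]
  have := hf.card_add_card_compl_le A
  refine and_congr_right fun _ => ?_
  omega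

lemma IsKonigEgervary.ker_subset_core {G : SimpleGraph V} (hG : G.IsKonigEgervary) :
    G.ker ⊆ G.core := by
  intro v hv
  rw [mem_core]
  intro S hS
  obtain ⟨f, hf⟩ := hG.exists_isSaturating hS
  refine mem_ker.1 hv S ((hf.isCriticalIndepSet_iff hS.isIndepSet).2 ⟨hS.isIndepSet, ?_⟩)
  rw [hf.nbhd_eq_compl hS.isIndepSet, add_comm]

/-! ### Matchings avoiding a vertex of the kernel -/

/-- Hall's marriage theorem for a relation between vertices, with the Hall condition restricted to
subsets `Y` of `P`; here `Z` is the set of vertices related to `Y`. -/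
lemma exists_injOn_of_hall {R : V → V → Prop} {P : Finset V}
    (h : ∀ Y ⊆ P, ∀ Z : Finset V, (∀ s, s ∈ Z ↔ ∃ y ∈ Y, R y s) → Y.card ≤ Z.card) :
    ∃ f : V → V, Set.InjOn f (P : Set V) ∧ ∀ x ∈ P, R x (f x) := by
  classical
  obtain ⟨f, hf, hR⟩ := (Finset.all_card_le_biUnion_card_iff_existsInjective'
    (fun x : P => Finset.univ.filter fun s => R x s)).1 fun Y => by
      have hY : Y.map (Function.Embedding.subtype _) ⊆ P := by
        intro x hx
        obtain ⟨y, -, rfl⟩ := Finset.mem_map.1 hx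
        exact y.2
      have := h _ hY (Y.biUnion fun x : P => Finset.univ.filter fun s => R x s) (by simp)
      rwa [Finset.card_map] at this
  refine ⟨fun x => if hx : x ∈ P then f ⟨x, hx⟩ else x, ?_, ?_⟩
  · intro x hx y hy hxy
    rw [Finset.mem_coe] at hx hy
    simp only [hx, hy, dif_pos] at hxy
    exact congrArg Subtype.val (hf hxy)
  · intro x hx
    simpa [hx] using hR ⟨x, hx⟩

/-- A vertex of the kernel is missed by some maximum matching. -/
lemma IsKonigEgervary.exists_isSaturating_avoiding {G : SimpleGraph V} (hG : G.IsKonigEgervary)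
    {v : V} (hv : v ∈ G.ker) {S : Finset V} (hS : G.IsMaximumIndepSet S) :
    ∃ f, G.IsSaturating S f ∧ ∀ x ∉ S, f x ≠ v := by
  classical
  obtain ⟨g, hg⟩ := hG.exists_isSaturating hS
  obtain ⟨f, hf, hR⟩ := exists_injOn_of_hall (P := Sᶜ)
    (R := fun x s => s ∈ S ∧ s ≠ v ∧ G.Adj x s) (by
    intro Y hY Z hZ
    by_contra! hlt
    -- `A = S \ N(Y)`, the set witnessing that `v` is not in the kernel
    set A : Finset V := S.filter fun s => ∀ y ∈ Y, ¬ G.Adj y s with hA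
    -- if `v` had no neighbour in `Y`, the images of `Y` under `g` would all lie in `Z`
    have hAv : v ∈ A → (Y.image g).card < Y.card := by
      intro hvA
      refine (Finset.card_le_card ?_).trans_lt hlt
      intro s hs
      obtain ⟨y, hy, rfl⟩ := Finset.mem_image.1 hs
      have h1 := hg.2 y (by simpa using hY hy)
      refine (hZ _).2 ⟨y, hy, h1.1, ?_, h1.2⟩
      intro h
      exact (Finset.mem_filter.1 hvA).2 y hy (h ▸ h1.2)
    have hginj : (Y.image g).card = Y.card := Finset.card_image_of_injOn
      (hg.1.mono fun x hx => by simpa using hY hx)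
    have hvA : v ∉ A := fun h => (hAv h).ne hginj
    have hAS : A ⊆ S := Finset.filter_subset _ _
    refine hvA (mem_ker.1 hv A ((hg.isCriticalIndepSet_iff hS.isIndepSet).2 ⟨?_, ?_⟩))
    · exact hS.isIndepSet.mono hAS
    · have h1 : G.nbhd A ⊆ Sᶜ \ Y := by
        intro x hx
        obtain ⟨s, hs, hxs⟩ := mem_nbhd.1 hx
        rw [Finset.mem_sdiff, Finset.mem_compl]
        exact ⟨fun h => not_adj_of_isIndepSet hS.isIndepSet h (hAS hs) hxs,
          fun h => (Finset.mem_filter.1 hs).2 x h hxs⟩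
      have h2 := Finset.card_le_card h1
      have h3 := Finset.card_sdiff_add_card_eq_card hY
      have h4 : S ⊆ A ∪ insert v Z := by
        intro s hs
        by_cases hsv : s = v
        · simp [hsv]
        · by_cases hsA : s ∈ A
          · simp [hsA]
          · simp only [hA, Finset.mem_filter, not_and, not_forall, not_not] at hsA
            obtain ⟨y, hy, hys⟩ := hsA hs
            have : s ∈ Z := (hZ s).2 ⟨y, hy, hs, hsv, hys⟩
            simp [this]
      have h5 := (Finset.card_le_card h4).trans (Finset.card_union_le _ _)
      have h6 := Finset.card_insert_le v Z
      omega)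
  have hR' : ∀ x ∉ S, f x ∈ S ∧ f x ≠ v ∧ G.Adj x (f x) := fun x hx => hR x (by simpa using hx)
  exact ⟨f, ⟨by simpa using hf, fun x hx => ⟨(hR' x hx).1, (hR' x hx).2.2⟩⟩,
    fun x hx => (hR' x hx).2.1⟩

/-! ### Deleting a vertex -/

/-- A saturating map that never takes the value `v` restricts to the graph without `v`. -/
lemma IsSaturating.isKonigEgervary_induce {G : SimpleGraph V} {S : Finset V} {f : V → V}
    (hS : G.IsIndepSet (S : Set V)) (hf : G.IsSaturating S f) {v : V} (hfv : ∀ x ∉ S, f x ≠ v) :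
    (G.induce ({v}ᶜ : Set V)).IsKonigEgervary := by
  classical
  let f' : ({v}ᶜ : Set V) → ({v}ᶜ : Set V) := fun x => if h : f x ≠ v then ⟨f x, h⟩ else x
  have hf' : ∀ x : ({v}ᶜ : Set V), (x : V) ∉ S → (f' x : V) = f x := fun x hx => by
    simp [f', hfv x hx]
  have hmem : ∀ x : ({v}ᶜ : Set V), x ∈ Finset.univ.filter (fun x : ({v}ᶜ : Set V) => (x : V) ∈ S) ↔
      (x : V) ∈ S := by simp
  refine .of_isSaturating (S := Finset.univ.filter fun x : ({v}ᶜ : Set V) => (x : V) ∈ S)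
    (f := f') ?_ ⟨?_, ?_⟩
  · refine isIndepSet_of_forall_not_adj fun x hx y hy h => ?_
    rw [hmem] at hx hy
    exact not_adj_of_isIndepSet hS hx hy h
  · intro x hx y hy hxy
    rw [Set.mem_compl_iff, Finset.mem_coe, hmem] at hx hy
    refine Subtype.ext (hf.1 hx hy ?_)
    rw [← hf' x hx, ← hf' y hy, hxy]
  · intro x hx
    rw [hmem] at hx
    rw [hmem, hf' x hx, induce_adj, hf' x hx]
    exact hf.2 x hx

/-- If `v` lies in every maximum independent set, then `α(G - v) < α(G)`. When `G - v` is
König–Egerváry, this makes its critical difference smaller than that of `G`, so no critical set of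
`G` misses `v`. -/
lemma IsKonigEgervary.mem_ker_of_induce {G : SimpleGraph V} (hG : G.IsKonigEgervary) {v : V}
    (hv : v ∈ G.core) (hGv : (G.induce ({v}ᶜ : Set V)).IsKonigEgervary) : v ∈ G.ker := by
  classical
  obtain ⟨S, hS⟩ := G.exists_isMaximumIndepSet
  obtain ⟨f, hf⟩ := hG.exists_isSaturating hS
  obtain ⟨T, hT⟩ := (G.induce ({v}ᶜ : Set V)).exists_isMaximumIndepSet
  obtain ⟨g, hg⟩ := hGv.exists_isSaturating hT
  have hTS : T.card < S.card := by
    by_contra! hle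
    have hind : G.IsIndepSet ((T.map (Function.Embedding.subtype _) : Finset V) : Set V) := by
      refine isIndepSet_of_forall_not_adj fun x hx y hy h => ?_
      obtain ⟨x', hx', rfl⟩ := Finset.mem_map.1 hx
      obtain ⟨y', hy', rfl⟩ := Finset.mem_map.1 hy
      exact not_adj_of_isIndepSet hT.isIndepSet hx' hy' h
    have hmax : G.IsMaximumIndepSet (T.map (Function.Embedding.subtype _)) :=
      ⟨hind, fun t ht => (hS.maximum t ht).trans (by simpa using hle)⟩
    obtain ⟨x, -, hx⟩ := Finset.mem_map.1 (mem_core.1 hv _ hmax)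
    exact x.2 hx
  rw [mem_ker]
  intro A hA
  by_contra hvA
  have hA' := ((hf.isCriticalIndepSet_iff hS.isIndepSet).1 hA).2
  set B : Finset ({v}ᶜ : Set V) := Finset.univ.filter fun x => (x : V) ∈ A with hB
  have hBA : B.map (Function.Embedding.subtype _) = A := by
    ext x
    simp only [hB, Finset.mem_map, Finset.mem_filter, Finset.mem_univ, true_and]
    constructor
    · rintro ⟨y, hy, rfl⟩
      exact hy
    · intro hx
      exact ⟨⟨x, fun h => hvA (h ▸ hx)⟩, hx, rfl⟩
  have h1 : ((G.induce ({v}ᶜ : Set V)).nbhd B).card ≤ (G.nbhd A).card := by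
    rw [← Finset.card_map (Function.Embedding.subtype _)]
    apply Finset.card_le_card
    intro x hx
    obtain ⟨x', hx', rfl⟩ := Finset.mem_map.1 hx
    obtain ⟨y, hy, hxy⟩ := mem_nbhd.1 hx'
    exact mem_nbhd.2 ⟨y, (Finset.mem_filter.1 hy).2, hxy⟩
  have h2 : B.card = A.card := by rw [← hBA, Finset.card_map]
  have h3 := hg.card_add_card_compl_le B
  have h4 : Fintype.card ({v}ᶜ : Set V) + 1 = Fintype.card V := by
    rw [Fintype.card_compl_set]
    have : 0 < Fintype.card V := Fintype.card_pos_iff.2 ⟨v⟩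
    simp only [Fintype.card_unique]
    omega
  have h5 := Finset.card_add_card_compl T
  have h6 := Finset.card_add_card_compl S
  omega

lemma IsKonigEgervary.induce_compl_singleton_iff {G : SimpleGraph V} (hG : G.IsKonigEgervary)
    (v : V) : (G.induce ({v}ᶜ : Set V)).IsKonigEgervary ↔ (v ∈ G.core → v ∈ G.ker) := by
  refine ⟨fun h hv => hG.mem_ker_of_induce hv h, fun h => ?_⟩
  by_cases hv : v ∈ G.core
  · obtain ⟨S, hS⟩ := G.exists_isMaximumIndepSet
    obtain ⟨f, hf, hfv⟩ := hG.exists_isSaturating_avoiding (h hv) hS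
    exact hf.isKonigEgervary_induce hS.isIndepSet hfv
  · rw [mem_core] at hv
    push Not at hv
    obtain ⟨S, hS, hvS⟩ := hv
    obtain ⟨f, hf⟩ := hG.exists_isSaturating hS
    exact hf.isKonigEgervary_induce hS.isIndepSet fun x hx h => hvS (h ▸ (hf.2 x hx).1)

/-! ### Deleting an edge -/

/-- A saturating map that does not match `a` with `b` survives the deletion of the edge `ab`. -/
lemma IsSaturating.isKonigEgervary_deleteEdges {G : SimpleGraph V} {S : Finset V} {f : V → V}
    (hS : G.IsIndepSet (S : Set V)) (hf : G.IsSaturating S f) {a b : V}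
    (ha : a ∉ S → f a ≠ b) (hb : b ∉ S → f b ≠ a) :
    (G.deleteEdges {s(a, b)}).IsKonigEgervary := by
  refine .of_isSaturating (S := S) (f := f) ?_ ⟨hf.1, fun x hx => ⟨(hf.2 x hx).1, ?_⟩⟩
  · exact isIndepSet_of_forall_not_adj fun x hx y hy h =>
      not_adj_of_isIndepSet hS hx hy (deleteEdges_singleton_adj.1 h).1
  · refine deleteEdges_singleton_adj.2 ⟨(hf.2 x hx).2, ?_⟩
    rintro (⟨rfl, h⟩ | ⟨rfl, h⟩)
    · exact ha hx h
    · exact hb hx h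

lemma IsKonigEgervary.deleteEdges_of_mem_ker {G : SimpleGraph V} (hG : G.IsKonigEgervary) {a b : V}
    (ha : a ∈ G.ker) : (G.deleteEdges {s(a, b)}).IsKonigEgervary := by
  obtain ⟨S, hS⟩ := G.exists_isMaximumIndepSet
  obtain ⟨f, hf, hfa⟩ := hG.exists_isSaturating_avoiding ha hS
  exact hf.isKonigEgervary_deleteEdges hS.isIndepSet
    (fun h => absurd (mem_core.1 (hG.ker_subset_core ha) S hS) h) (hfa b)

/-- If `f` matches the part `Y` of `Sᶜ` onto `f '' Y`, an independent set `T` has at most `|S| - |Y|`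
vertices outside `Y ∪ f '' Y`, since the rest of `V` is covered by the `|S| - |Y|` remaining
vertices of `S` together with their partners. -/
lemma IsSaturating.card_sdiff_le {G : SimpleGraph V} {S T Y : Finset V} {f : V → V}
    (hf : G.IsSaturating S f) (hT : G.IsIndepSet (T : Set V)) (hY : Y ⊆ Sᶜ) :
    (T \ (Y ∪ Y.image f)).card ≤ (S \ Y.image f).card := by
  refine Finset.card_le_card_of_injOn (fun x => if x ∈ S then x else f x) ?_ ?_
  · intro x hx
    simp only [Finset.coe_sdiff, Set.mem_sdiff, Finset.mem_coe, Finset.mem_union] at hx ⊢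
    split_ifs with h
    · exact ⟨h, fun h' => hx.2 (Or.inr h')⟩
    · refine ⟨(hf.2 x h).1, fun h' => ?_⟩
      obtain ⟨y, hy, hyx⟩ := Finset.mem_image.1 h'
      have : y = x := hf.1 (by simpa using hY hy) h hyx
      exact hx.2 (Or.inl (this ▸ hy))
  · intro x hx y hy hxy
    have hxT : x ∈ T := (Finset.mem_sdiff.1 hx).1
    have hyT : y ∈ T := (Finset.mem_sdiff.1 hy).1
    dsimp only at hxy
    split_ifs at hxy with h1 h2 h2
    · exact hxy
    · exact absurd (hxy ▸ hxT) fun h => not_adj_of_isIndepSet hT hyT h (hf.2 y h2).2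
    · exact absurd (hxy ▸ hyT) fun h => not_adj_of_isIndepSet hT hxT h (hf.2 x h1).2
    · exact hf.1 h1 h2 hxy

/-- Suppose `f` saturates `S`. If no saturating map of `S` survives the deletion of `ab`, then some
`Y ⊆ Sᶜ` is matched by `f` onto all of its neighbours in `S`, and `b` is one of them whose only
neighbour in `Y` is `a`. -/
lemma IsSaturating.exists_tight_set {G : SimpleGraph V} {S : Finset V} {f : V → V}
    (hf : G.IsSaturating S f) {a b : V} (hb : b ∈ S)
    (hno : ¬ ∃ g, (G.deleteEdges {s(a, b)}).IsSaturating S g) :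
    ∃ Y ⊆ Sᶜ, (∀ y ∈ Y, ∀ s ∈ S, G.Adj y s → s ∈ Y.image f) ∧ b ∈ Y.image f ∧
      ∀ y ∈ Y, G.Adj y b → y = a := by
  classical
  -- the failing Hall condition gives `Y`, with `Z` its `S`-neighbours in the graph without `ab`
  have hhall : ∃ Y ⊆ Sᶜ, ∃ Z : Finset V,
      (∀ s, s ∈ Z ↔ ∃ y ∈ Y, s ∈ S ∧ (G.deleteEdges {s(a, b)}).Adj y s) ∧ Z.card < Y.card := by
    by_contra! h
    obtain ⟨g, hg, hgR⟩ := exists_injOn_of_hall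
      (R := fun y s => s ∈ S ∧ (G.deleteEdges {s(a, b)}).Adj y s) h
    exact hno ⟨g, by simpa using hg, fun x hx => hgR x (by simpa using hx)⟩
  obtain ⟨Y, hY, Z, hZ, hlt⟩ := hhall
  have hYS : ∀ y ∈ Y, y ∉ S := fun y hy => by simpa using hY hy
  have hcard : (Y.image f).card = Y.card := Finset.card_image_of_injOn
    (hf.1.mono fun x hx => hYS x hx)
  have hnb : ∀ y ∈ Y, ∀ s ∈ S, G.Adj y s → s ∈ Z ∨ (y = a ∧ s = b) := by
    intro y hy s hs hys
    by_cases h : y = a ∧ s = b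
    · exact Or.inr h
    · refine Or.inl ((hZ s).2 ⟨y, hy, hs, deleteEdges_singleton_adj.2 ⟨hys, ?_⟩⟩)
      rintro (h' | ⟨rfl, -⟩)
      · exact h h'
      · exact hYS _ hy hb
  have hsub : Y.image f ⊆ insert b Z := by
    intro s hs
    obtain ⟨y, hy, rfl⟩ := Finset.mem_image.1 hs
    have := hf.2 y (hYS y hy)
    rcases hnb y hy _ this.1 this.2 with h | h
    · exact Finset.mem_insert_of_mem h
    · exact Finset.mem_insert.2 (Or.inl h.2)
  have hins := Finset.card_insert_le b Z
  -- `|Z| < |Y| = |f '' Y|` leaves no room: `f '' Y` is `Z` together with the new vertex `b`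
  have heq : Y.image f = insert b Z := Finset.eq_of_subset_of_card_le hsub (by omega)
  have hbZ : b ∉ Z := by
    intro h
    rw [Finset.insert_eq_of_mem h] at heq
    rw [heq] at hcard
    omega
  refine ⟨Y, hY, ?_, ?_, ?_⟩
  · intro y hy s hs hys
    rw [heq, Finset.mem_insert]
    rcases hnb y hy s hs hys with h | h
    · exact Or.inr h
    · exact Or.inl h.2
  · rw [heq]
    exact Finset.mem_insert_self _ _
  · intro y hy hyb
    rcases hnb y hy b hb hyb with h | h
    · exact absurd h hbZ
    · exact h.1

/-- If neither endpoint lies in the core, then deleting the edge either keeps a maximum matching or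
increases the independence number. -/
lemma IsKonigEgervary.deleteEdges_of_notMem_core {G : SimpleGraph V} (hG : G.IsKonigEgervary)
    {a b : V} (ha : a ∉ G.core) (hb : b ∉ G.core) :
    (G.deleteEdges {s(a, b)}).IsKonigEgervary := by
  classical
  rw [mem_core] at ha hb
  push Not at ha hb
  obtain ⟨S, hS, haS⟩ := ha
  obtain ⟨T, hT, hbT⟩ := hb
  obtain ⟨f, hf⟩ := hG.exists_isSaturating hS
  by_cases hbS : b ∈ S
  swap
  · exact hf.isKonigEgervary_deleteEdges hS.isIndepSet (fun h h' => hbS (h' ▸ (hf.2 a h).1))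
      (fun h h' => haS (h' ▸ (hf.2 b h).1))
  by_cases hex : ∃ g, (G.deleteEdges {s(a, b)}).IsSaturating S g
  · obtain ⟨g, hg⟩ := hex
    refine .of_isSaturating (isIndepSet_of_forall_not_adj fun x hx y hy h => ?_) hg
    exact not_adj_of_isIndepSet hS.isIndepSet hx hy (deleteEdges_singleton_adj.1 h).1
  obtain ⟨Y, hY, hYn, hbY, hYb⟩ := hf.exists_tight_set hbS hex
  have hYS : ∀ y ∈ Y, y ∉ S := fun y hy => by simpa using hY hy
  have hfYS : Y.image f ⊆ S := by
    intro s hs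
    obtain ⟨y, hy, rfl⟩ := Finset.mem_image.1 hs
    exact (hf.2 y (hYS y hy)).1
  -- exchange `S` for `T` on `Y ∪ f '' Y`
  set U : Finset V := (S \ Y.image f) ∪ (T ∩ (Y ∪ Y.image f)) with hU
  have hUcard : S.card ≤ U.card := by
    rw [hU, Finset.card_union_of_disjoint]
    · have h1 := hf.card_sdiff_le hT.isIndepSet hY
      have h2 := Finset.card_sdiff_add_card_inter T (Y ∪ Y.image f)
      have h3 := hT.maximum S hS.isIndepSet
      omega
    · rw [Finset.disjoint_left]
      intro x hx hx'
      simp only [Finset.mem_sdiff, Finset.mem_inter, Finset.mem_union] at hx hx'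
      rcases hx'.2 with h | h
      · exact hYS x h hx.1
      · exact hx.2 h
  have hbU : b ∉ U := by
    simp only [hU, Finset.mem_union, Finset.mem_sdiff, Finset.mem_inter, not_or, not_and]
    exact ⟨fun _ h => h hbY, fun h => absurd h hbT⟩
  -- a vertex of `U` is in `S`, or in both `Y` and `T`
  have hUmem : ∀ x ∈ U, x ∈ S ∧ (x ∈ Y.image f → x ∈ T) ∨ x ∈ Y ∧ x ∈ T := by
    intro x hx
    simp only [hU, Finset.mem_union, Finset.mem_sdiff, Finset.mem_inter] at hx
    rcases hx with ⟨h1, h2⟩ | ⟨h1, h2 | h2⟩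
    · exact Or.inl ⟨h1, fun h => absurd h h2⟩
    · exact Or.inr ⟨h2, h1⟩
    · exact Or.inl ⟨hfYS h2, fun _ => h1⟩
  have hUind : ∀ x ∈ U, ∀ y ∈ U, ¬ G.Adj x y := by
    intro x hx y hy h
    rcases hUmem x hx with ⟨hxS, hxT⟩ | ⟨hxY, hxT⟩ <;>
      rcases hUmem y hy with ⟨hyS, hyT⟩ | ⟨hyY, hyT⟩
    · exact not_adj_of_isIndepSet hS.isIndepSet hxS hyS h
    · exact not_adj_of_isIndepSet hT.isIndepSet (hxT (hYn y hyY x hxS h.symm)) hyT h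
    · exact not_adj_of_isIndepSet hT.isIndepSet hxT (hyT (hYn x hxY y hyS h)) h
    · exact not_adj_of_isIndepSet hT.isIndepSet hxT hyT h
  have hUb : ∀ x ∈ U, G.Adj x b → x = a := by
    intro x hx h
    rcases hUmem x hx with ⟨hxS, -⟩ | ⟨hxY, -⟩
    · exact absurd h (not_adj_of_isIndepSet hS.isIndepSet hxS hbS)
    · exact hYb x hxY h
  -- `|U ∪ {b}| = α(G) + 1`, and `f` still matches every vertex of `Sᶜ` other than `a`
  refine .of_card_le (S := insert b U) (P := Sᶜ.erase a) (f := f) ?_ ?_ ?_ ?_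
  · refine isIndepSet_of_forall_not_adj fun x hx y hy h => ?_
    obtain ⟨hxy, hne⟩ := deleteEdges_singleton_adj.1 h
    rcases Finset.mem_insert.1 hx with rfl | hxU <;>
      rcases Finset.mem_insert.1 hy with rfl | hyU
    · exact hxy.ne rfl
    · exact hne (Or.inr ⟨rfl, hUb y hyU hxy.symm⟩)
    · exact hne (Or.inl ⟨hUb x hxU hxy, rfl⟩)
    · exact hUind x hxU y hyU hxy
  · exact hf.1.mono fun x hx => by simpa using Finset.mem_of_mem_erase hx
  · intro x hx
    obtain ⟨hxa, hxS⟩ := Finset.mem_erase.1 hx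
    rw [Finset.mem_compl] at hxS
    obtain ⟨h1, h2⟩ := hf.2 x hxS
    refine ⟨fun h => Finset.mem_compl.1 (Finset.mem_of_mem_erase h) h1,
      deleteEdges_singleton_adj.2 ⟨h2, ?_⟩⟩
    rintro (⟨h, -⟩ | ⟨rfl, -⟩)
    · exact hxa h
    · exact hxS hbS
  · rw [Finset.card_insert_of_notMem hbU, Finset.card_erase_of_mem (by simpa using haS),
      Nat.card_eq_fintype_card]
    have := Finset.card_add_card_compl S
    omega

lemma IsKonigEgervary.deleteEdges_of_core_eq_ker {G : SimpleGraph V} (hG : G.IsKonigEgervary)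
    (h : G.core = G.ker) (a b : V) : (G.deleteEdges {s(a, b)}).IsKonigEgervary := by
  by_cases ha : a ∈ G.core
  · exact hG.deleteEdges_of_mem_ker (h ▸ ha)
  by_cases hb : b ∈ G.core
  · rw [Sym2.eq_swap]
    exact hG.deleteEdges_of_mem_ker (h ▸ hb)
  · exact hG.deleteEdges_of_notMem_core ha hb

end Fintype

end SimpleGraph

/-! ### Counting hereditary vertices and edges -/

theorem mainTheorem11 {V : Type*} [Finite V] (G : SimpleGraph V) (hG : G.IsKonigEgervary) :
    (G.vertexHeredity = Nat.card V ↔ G.core = G.ker) ∧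
      (G.core = G.ker → G.edgeHeredity = G.edgeSet.ncard) := by
  classical
  have := Fintype.ofFinite V
  refine ⟨?_, fun h => ?_⟩
  · rw [SimpleGraph.vertexHeredity, ← Set.eq_univ_iff_ncard, Set.eq_univ_iff_forall]
    simp only [Set.mem_ofPred_eq, hG.induce_compl_singleton_iff]
    exact ⟨fun h => Set.Subset.antisymm h hG.ker_subset_core, fun h v hv => h ▸ hv⟩
  · rw [SimpleGraph.edgeHeredity]
    congr 1
    ext e
    refine ⟨fun he => he.1, fun he => ⟨he, ?_⟩⟩
    induction e using Sym2.ind with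
    | _ a b => exact hG.deleteEdges_of_core_eq_ker h a b
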